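/- All graphs are finite and simple (the empty graph is allowed). For graphs $G,H$ let $\mathbf{Col}(G,H)$ be the graph whose vertices are the homomorphisms $G\to H$, two distinct homomorphisms being adjacent if they differ on exactly one vertex of $G$; $G$ is $H$-mixing if $\mathbf{Col}(G,H)$ is connected (in particular non-empty). For positive integers $p,q$ with $p/q\ge 2$, the circular clique $G_{p,q}$ has vertex set $\{0,\dots,p-1\}$, with $u,v$ adjacent if and only if $q\le |u-v|\le p-q$. The circular mixing number of $G$ is $$m_c(G)=\inf\Big\{\tfrac pq \;:\; p,q\in\mathbb{Z}^{+},\ \tfrac pq\ge 2,\ G\text{ is }G_{p,q}\text{-mixing}\Big\}.$$ Let $\omega(G)$ be the clique number of $G$ and $C_n$ the cycle on $n$ vertices. **Theorem.** Let $G$ be a finite simple graph. 1. If $G$ is bipartite, then: (a) there is an integer $k\ge 1$ such that $G$ is $C_{2k+1}$-mixing; (b) there is $k_0$ such that $G$ is $C_{2k+1}$-mixing for every $k\ge k_0$; more precisely, $G$ is $C_{2k+1}$-mixing for every integer $k\ge 1$ such that every cycle of $G$ has length less than $4k+2$; (c) $m_c(G)=2$. 2. If $G$ is not bipartite, then $m_c(G)\ge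 \max\{4,\ \omega(G)+1\}$. -/

import Mathlib

/-- The reconfiguration graph `Col(G, H)`: its vertices are the homomorphisms `G → H`, and two
distinct homomorphisms are adjacent when they differ on at most one vertex of `G`.
(The loops are dropped; they do not affect connectedness.) -/
def colGraph {V W : Type*} (G : SimpleGraph V) (H : SimpleGraph W) : SimpleGraph (G →g H) where
  Adj f g := f ≠ g ∧ {v : V | f v ≠ g v}.Subsingleton
  symm := ⟨fun _ _ h => ⟨h.1.symm, fun _ hx _ hy => h.2 (Ne.symm hx) (Ne.symm hy)⟩⟩
  loopless := ⟨fun _ h => h.1 rfl⟩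

/-- `G` is `H`-mixing when `Col(G, H)` is connected. A connected graph has at least one vertex,
so `G` has to admit an `H`-colouring. -/
def IsMixing {V W : Type*} (G : SimpleGraph V) (H : SimpleGraph W) : Prop :=
  (colGraph G H).Connected

/-- The circular clique `G_{p,q}`: vertices `0, …, p - 1`, with `u` adjacent to `v` if and only if
`q ≤ |u - v| ≤ p - q`. (For positive `q`, the case in use, the condition `u ≠ v` is automatic.) -/
def circularClique (p q : ℕ) : SimpleGraph (Fin p) where
  Adj u v := u ≠ v ∧ (q : ℤ) ≤ |(u : ℤ) - (v : ℤ)| ∧ |(u : ℤ) - (v : ℤ)| ≤ (p : ℤ) - (q : ℤ)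
  symm := ⟨fun u v h => by rw [abs_sub_comm]; exact ⟨h.1.symm, h.2⟩⟩
  loopless := ⟨fun _ h => h.1 rfl⟩

/-- The circular mixing number of `G`: the infimum of `p / q` over all positive integers `p, q`
with `p / q ≥ 2` such that `G` is `G_{p,q}`-mixing. -/
noncomputable def circularMixingNumber {V : Type*} (G : SimpleGraph V) : ℝ :=
  sInf {r : ℝ | ∃ p q : ℕ, 0 < q ∧ 2 * q ≤ p ∧ IsMixing G (circularClique p q) ∧
    r = (p : ℝ) / (q : ℝ)}

/-! ### Recolouring steps, invariants along them, and isomorphic targets. -/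

section Reconfiguration

variable {V W W' : Type*} {G : SimpleGraph V} {H : SimpleGraph W} {H' : SimpleGraph W'}

/-! Bipartite case. With n = 2k+1 odd, a colouring by residues mod n together with the parity given
by a bipartition determines residues mod 2n that change by ±1 along edges. When all cycles are
shorter than 2n, the steps around each cycle sum to exactly 0, so the residues lift to an integer
height function (`exists_lift_of_cycle_length_lt`). Pushing extrema by 2 flattens any height
function to the 0-1 bipartition colouring (`heightHom_reachable`), so all colourings are connected.
Since G_{2k+1,k} is an odd cycle, the ratios 2 + 1/k give m_c = 2.

Non-bipartite case. Each bound compares a colouring with its mirror image through an invariant of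
recolouring. If p/q < 4, the clockwise distances along edges change only by an integer potential, so
winding around closed walks is preserved; reflection sends d to p - d, which forces closed walks to
be even (`isBipartite_of_isMixing`). If p/q < m + 1 with m ≥ 3, the cyclic order of the colours on
an m-clique is frozen, while reflection reverses it (`succ_mul_le_of_isMixing`). -/

theorem colGraph_reachable_of_subsingleton {f g : G →g H}
    (h : {v : V | f v ≠ g v}.Subsingleton) : (colGraph G H).Reachable f g := by
  by_cases hfg : f = g
  · exact hfg ▸ SimpleGraph.Reachable.refl _
  · exact SimpleGraph.Adj.reachable (show (colGraph G H).Adj f g from ⟨hfg, h⟩)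

theorem colGraph_exists_eq_of_adj {f g : G →g H} (h : (colGraph G H).Adj f g) :
    ∃ v, ∀ w, w ≠ v → f w = g w := by
  obtain ⟨hne, hs⟩ := h
  obtain ⟨v, hv⟩ : ∃ v, f v ≠ g v := by
    by_contra hcon
    push Not at hcon
    exact hne (RelHom.ext hcon)
  refine ⟨v, fun w hw => ?_⟩
  by_contra hfw
  exact hw (hs hfw hv)

/-- A reflexive transitive relation on colourings which holds along every recolouring step holds
between any two colourings of the same component. -/
theorem rel_of_colGraph_reachable {R : (G →g H) → (G →g H) → Prop} (refl : ∀ f, R f f)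
    (trans : ∀ f g h, R f g → R g h → R f h)
    (step : ∀ f g (v : V), (∀ w, w ≠ v → f w = g w) → R f g) {f g : G →g H}
    (h : (colGraph G H).Reachable f g) : R f g := by
  obtain ⟨p⟩ := h
  induction p with
  | nil => exact refl _
  | cons hadj _ ih =>
    obtain ⟨v, hv⟩ := colGraph_exists_eq_of_adj hadj
    exact trans _ _ _ (step _ _ v hv) ih

/-- An isomorphism of targets induces an isomorphism of reconfiguration graphs. -/
def colGraphIso (G : SimpleGraph V) (e : H ≃g H') : colGraph G H ≃g colGraph G H' where
  toFun f := e.toHom.comp f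
  invFun f := e.symm.toHom.comp f
  left_inv f := by ext v; simp
  right_inv f := by ext v; simp
  map_rel_iff' {f g} := by
    have h1 : ∀ v, e (f v) = e (g v) ↔ f v = g v := fun v => e.injective.eq_iff
    have h2 : e.toHom.comp f = e.toHom.comp g ↔ f = g := by
      simp only [RelHom.ext_iff]
      exact forall_congr' h1
    have h3 : {v : V | e.toHom.comp f v ≠ e.toHom.comp g v} = {v | f v ≠ g v} := by
      ext v
      exact not_congr (h1 v)
    change (_ ≠ _ ∧ _) ↔ (_ ≠ _ ∧ _)
    exact and_congr (not_congr h2) (by rw [← h3]; rfl)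

theorem isMixing_congr (e : H ≃g H') : IsMixing G H ↔ IsMixing G H' :=
  (colGraphIso G e).connected_iff

end Reconfiguration

/-! ### Integer height functions and mixing for odd cycles. -/

section Heights

variable {V : Type*} {G : SimpleGraph V}

theorem abs_sub_le_length {F : V → ℤ}
    (hF : ∀ u v, G.Adj u v → F u - F v = 1 ∨ F u - F v = -1) {u v : V} (p : G.Walk u v) :
    |F u - F v| ≤ p.length := by
  induction p with
  | nil => simp
  | cons h p ih =>
    have := hF _ _ h
    rw [SimpleGraph.Walk.length_cons]
    push_cast
    rw [abs_le] at ih ⊢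
    omega

/-- A map to `ℤ` that changes by `±1` modulo `N` along every edge can be changed by multiples of
`N` so that it changes by exactly `±1`, provided that all cycles are shorter than `N`. -/
theorem exists_lift_of_cycle_length_lt [Finite V] (N : ℕ) (g : V → ℤ)
    (hg : ∀ u v, G.Adj u v → (N : ℤ) ∣ g u - g v - 1 ∨ (N : ℤ) ∣ g u - g v + 1)
    (hcyc : ∀ (v : V) (c : G.Walk v v), c.IsCycle → c.length < N) :
    ∃ F : V → ℤ, (∀ v, (N : ℤ) ∣ F v - g v) ∧
      ∀ u v, G.Adj u v → F u - F v = 1 ∨ F u - F v = -1 := by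
  classical
  let S : Set (SimpleGraph V) := {H | H ≤ G ∧ ∃ F : V → ℤ, (∀ v, (N : ℤ) ∣ F v - g v) ∧
      ∀ u v, H.Adj u v → F u - F v = 1 ∨ F u - F v = -1}
  have hS : S.Nonempty := ⟨⊥, bot_le, g, by simp, by simp⟩
  -- Take a maximal subgraph that can be lifted. A missing edge either closes a cycle or joins two
  -- components.
  obtain ⟨H, ⟨hHG, F, hFg, hF⟩, hmax⟩ := S.toFinite.exists_maximal hS
  suffices hGH : G ≤ H from ⟨F, hFg, fun u v h => hF u v (hGH h)⟩
  by_contra hnot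
  obtain ⟨a, b, hab, hnab⟩ : ∃ a b, G.Adj a b ∧ ¬ H.Adj a b := by
    by_contra hcon
    push Not at hcon
    exact hnot fun a b h => hcon a b h
  have key : ∀ F' : V → ℤ, (∀ v, (N : ℤ) ∣ F' v - g v) →
      (∀ u v, H.Adj u v → F' u - F' v = 1 ∨ F' u - F' v = -1) →
      (F' a - F' b = 1 ∨ F' a - F' b = -1) → False := by
    intro F' h1 h2 h3
    have hmem : H ⊔ SimpleGraph.edge a b ∈ S := by
      refine ⟨sup_le hHG ?_, F', h1, ?_⟩
      · intro x y hxy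
        rw [SimpleGraph.edge_adj] at hxy
        rcases hxy.1 with ⟨rfl, rfl⟩ | ⟨rfl, rfl⟩
        · exact hab
        · exact hab.symm
      · intro x y hxy
        rw [SimpleGraph.sup_adj, SimpleGraph.edge_adj] at hxy
        rcases hxy with hxy | ⟨⟨rfl, rfl⟩ | ⟨rfl, rfl⟩, _⟩
        · exact h2 x y hxy
        · exact h3
        · omega
    refine hnab (hmax hmem le_sup_left ?_)
    rw [SimpleGraph.sup_adj, SimpleGraph.edge_adj]
    exact Or.inr ⟨Or.inl ⟨rfl, rfl⟩, hab.ne⟩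
  obtain ⟨ε, hε, t, ht⟩ : ∃ ε : ℤ, (ε = 1 ∨ ε = -1) ∧ (N : ℤ) ∣ F a - F b - ε := by
    have e1 := hFg a
    have e2 := hFg b
    rcases hg a b hab with h | h
    · refine ⟨1, Or.inl rfl, ?_⟩
      have := (h.add e1).sub e2
      ring_nf at this ⊢
      exact this
    · refine ⟨-1, Or.inr rfl, ?_⟩
      have := (h.add e1).sub e2
      ring_nf at this ⊢
      exact this
  by_cases hr : H.Reachable b a
  · obtain ⟨p, hp⟩ := hr.exists_isPath
    have hlen := abs_sub_le_length hF p
    have hc : (SimpleGraph.Walk.cons hab (p.mapLe hHG)).IsCycle := by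
      rw [SimpleGraph.Walk.cons_isCycle_iff]
      refine ⟨(SimpleGraph.Walk.isPath_mapLe hHG).2 hp, ?_⟩
      rw [SimpleGraph.Walk.edges_mapLe_eq_edges]
      exact fun h => hnab (p.adj_of_mem_edges h)
    have hlt := hcyc _ _ hc
    rw [SimpleGraph.Walk.length_cons, SimpleGraph.Walk.length_map] at hlt
    rw [abs_le] at hlen
    -- The path and the edge `ab` form a cycle of `G`, so |F a - F b - ε| ≤ p.length + 1 < N, and a
    -- multiple of N this small is 0.
    have ht0 : (N : ℤ) * t = 0 := by
      rw [← ht]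
      refine Int.eq_zero_of_abs_lt_dvd ⟨t, ht⟩ ?_
      rw [abs_lt]
      omega
    exact key F hFg hF (by omega)
  -- Here `a` lies outside the component of `b`; shifting that component by a multiple of N makes
  -- the step along `ab` equal to ε.
  · refine key (fun x => F x + if H.Reachable b x then F a - F b - ε else 0) ?_ ?_ ?_
    · intro v
      have := hFg v
      split_ifs
      · have := this.add (Dvd.intro t ht.symm)
        ring_nf at this ⊢
        exact this
      · simpa using this
    · intro u v huv
      have hiff : H.Reachable b u ↔ H.Reachable b v :=
        ⟨fun h => h.trans huv.reachable, fun h => h.trans huv.symm.reachable⟩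
      have := hF u v huv
      by_cases hv : H.Reachable b v
      · rw [if_pos hv, if_pos (hiff.2 hv)]
        omega
      · rw [if_neg hv, if_neg (mt hiff.1 hv)]
        omega
    · rw [if_neg hr, if_pos (SimpleGraph.Reachable.refl b)]
      omega

/-- The colouring by residues modulo `n` given by a height function. -/
def heightHom {n : ℕ} {H : SimpleGraph (ZMod n)}
    (hH : ∀ x y, H.Adj x y ↔ x - y = 1 ∨ y - x = 1) (F : V → ℤ)
    (hF : ∀ u v, G.Adj u v → F u - F v = 1 ∨ F u - F v = -1) : G →g H where
  toFun v := (F v : ZMod n)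
  map_rel' {u v} h := by
    rw [hH]
    rcases hF u v h with h | h
    · left
      exact_mod_cast congrArg (Int.cast : ℤ → ZMod n) h
    · right
      have h' : F v - F u = 1 := by omega
      exact_mod_cast congrArg (Int.cast : ℤ → ZMod n) h'

/-- Every height function can be flattened to the `0`-`1`-valued one of the same parity. -/
theorem heightHom_reachable [Finite V] {n : ℕ} {H : SimpleGraph (ZMod n)}
    (hH : ∀ x y, H.Adj x y ↔ x - y = 1 ∨ y - x = 1) (c : V → ℤ) (hc01 : ∀ v, c v = 0 ∨ c v = 1)
    (hc : ∀ u v, G.Adj u v → c u - c v = 1 ∨ c u - c v = -1) (F : V → ℤ)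
    (hpar : ∀ v, (2 : ℤ) ∣ F v - c v)
    (hF : ∀ u v, G.Adj u v → F u - F v = 1 ∨ F u - F v = -1) :
    (colGraph G H).Reachable (heightHom hH F hF) (heightHom hH c hc) := by
  classical
  have := Fintype.ofFinite V
  induction hs : ∑ v, (F v - c v).natAbs using Nat.strong_induction_on generalizing F with
  | _ s ih =>
  have move : ∀ (v : V) (a : ℤ), (∀ u, G.Adj u v → F u - a = 1 ∨ F u - a = -1) →
      (2 : ℤ) ∣ a - c v → (a - c v).natAbs < (F v - c v).natAbs →
      (colGraph G H).Reachable (heightHom hH F hF) (heightHom hH c hc) := by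
    intro v a hadj h2 hlt
    have hF' : ∀ x y, G.Adj x y → Function.update F v a x - Function.update F v a y = 1 ∨
        Function.update F v a x - Function.update F v a y = -1 := by
      intro x y hxy
      by_cases hx : x = v
      · subst hx
        have := hadj y hxy.symm
        rw [Function.update_self, Function.update_of_ne hxy.ne']
        omega
      · by_cases hy : y = v
        · subst hy
          rw [Function.update_self, Function.update_of_ne hx]
          exact hadj x hxy
        · rw [Function.update_of_ne hx, Function.update_of_ne hy]
          exact hF x y hxy
    refine SimpleGraph.Reachable.trans (v := heightHom hH (Function.update F v a) hF') ?_
      (ih _ ?_ _ ?_ hF' rfl)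
    · have hsub : ∀ x, heightHom hH F hF x ≠ heightHom hH (Function.update F v a) hF' x →
          x = v := by
        intro x hx
        by_contra hxv
        exact hx (congrArg (Int.cast : ℤ → ZMod n) (Function.update_of_ne hxv a F).symm)
      exact colGraph_reachable_of_subsingleton fun x hx y hy => (hsub x hx).trans (hsub y hy).symm
    · rw [← hs]
      refine Finset.sum_lt_sum (fun x _ => ?_) ⟨v, Finset.mem_univ v, by simpa using hlt⟩
      by_cases hx : x = v
      · subst hx
        simpa using hlt.le
      · rw [Function.update_of_ne hx]
    · intro x
      by_cases hx : x = v
      · subst hx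
        simpa using h2
      · rw [Function.update_of_ne hx]
        exact hpar x
  by_cases heq : F = c
  · subst heq
    exact SimpleGraph.Reachable.refl _
  · obtain ⟨w, hw⟩ := Function.ne_iff.1 heq
    have : Nonempty V := ⟨w⟩
    obtain ⟨v, hv⟩ := Finite.exists_max F
    obtain ⟨u, hu⟩ := Finite.exists_min F
    have hcw := hc01 w
    have hpw := hpar w
    have hvw := hv w
    have huw := hu w
    have hcv := hc01 v
    have hcu := hc01 u
    have hpv := hpar v
    have hpu := hpar u
    -- All neighbours of a maximum lie one below it, so it may drop by 2; dually for a minimum. If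
    -- no value exceeds 1, then F ≠ c and equal parity force a negative value.
    by_cases h1 : 1 < F v
    · refine move v (F v - 2) (fun x hx => ?_) (by omega) (by omega)
      have := hv x
      have := hF x v hx
      omega
    · refine move u (F u + 2) (fun x hx => ?_) (by omega) (by omega)
      have := hu x
      have := hF x u hx
      omega

/-- A bipartite graph whose cycles are shorter than `2 * n`, with `n` odd, is mixing for the
cycle of length `n`. -/
theorem isMixing_of_cycle_length_lt [Finite V] (hG : G.IsBipartite) (k : ℕ)
    {H : SimpleGraph (ZMod (2 * k + 1))} (hH : ∀ x y, H.Adj x y ↔ x - y = 1 ∨ y - x = 1)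
    (hcyc : ∀ (v : V) (c : G.Walk v v), c.IsCycle → c.length < 4 * k + 2) : IsMixing G H := by
  obtain ⟨C⟩ := hG
  have hc01 : ∀ v, ((C v : ℕ) : ℤ) = 0 ∨ ((C v : ℕ) : ℤ) = 1 := fun v => by
    have := (C v).isLt
    omega
  have hc : ∀ u v, G.Adj u v → ((C u : ℕ) : ℤ) - (C v : ℕ) = 1 ∨
      ((C u : ℕ) : ℤ) - (C v : ℕ) = -1 := fun u v h => by
    have h1 : (C u : ℕ) ≠ C v := fun h' => C.valid h (Fin.ext h')
    have := hc01 u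
    have := hc01 v
    omega
  have hreach : ∀ f : G →g H, (colGraph G H).Reachable f (heightHom hH _ hc) := by
    intro f
    have hz : ∀ v, ∃ z : ℤ, (z : ZMod (2 * k + 1)) = f v := fun v => ZMod.intCast_surjective _
    choose z hz using hz
    -- Chinese remaindering: as 2k+1 is odd, z + (2k+1)(z - C) is congruent to z mod 2k+1 and to C
    -- mod 2. Both moduli combine to 4k+2, the source of the bound on cycle lengths.
    have hstep : ∀ u v, G.Adj u v →
        ((4 * k + 2 : ℕ) : ℤ) ∣ (z u + (2 * k + 1) * (z u - (C u : ℕ))) -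
          (z v + (2 * k + 1) * (z v - (C v : ℕ))) - 1 ∨
        ((4 * k + 2 : ℕ) : ℤ) ∣ (z u + (2 * k + 1) * (z u - (C u : ℕ))) -
          (z v + (2 * k + 1) * (z v - (C v : ℕ))) + 1 := by
      intro u v huv
      have hodd := hc u v huv
      have hadj := (hH _ _).1 (f.map_adj huv)
      rw [← hz u, ← hz v] at hadj
      have hdvd : ∃ ε : ℤ, (ε = 1 ∨ ε = -1) ∧ ((2 * k + 1 : ℕ) : ℤ) ∣ z u - z v - ε := by
        rcases hadj with h | h
        · refine ⟨1, Or.inl rfl, ?_⟩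
          rw [← ZMod.intCast_zmod_eq_zero_iff_dvd]
          push_cast
          rw [h, sub_self]
        · refine ⟨-1, Or.inr rfl, ?_⟩
          rw [← ZMod.intCast_zmod_eq_zero_iff_dvd]
          push_cast
          linear_combination -h
      obtain ⟨ε, hε, t, ht⟩ := hdvd
      obtain ⟨s, hs⟩ : ∃ s : ℤ, ((C u : ℕ) : ℤ) - (C v : ℕ) - ε = 2 * s := by
        rcases hε with rfl | rfl <;> rcases hodd with h | h <;> rw [h]
        exacts [⟨0, by norm_num⟩, ⟨-1, by norm_num⟩, ⟨1, by norm_num⟩, ⟨0, by norm_num⟩]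
      have hfin : ((4 * k + 2 : ℕ) : ℤ) ∣ (z u + (2 * k + 1) * (z u - (C u : ℕ))) -
          (z v + (2 * k + 1) * (z v - (C v : ℕ))) - ε := by
        refine ⟨(k + 1) * t - s, ?_⟩
        push_cast at ht ⊢
        linear_combination (2 * k + 2) * ht - (2 * k + 1) * hs
      rcases hε with rfl | rfl
      · exact Or.inl hfin
      · right
        simpa only [sub_neg_eq_add] using hfin
    obtain ⟨F, hFg, hF⟩ := exists_lift_of_cycle_length_lt (4 * k + 2)
      (fun v => z v + (2 * k + 1) * (z v - (C v : ℕ))) hstep hcyc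
    have hfF : f = heightHom hH F hF := by
      ext v
      change f v = (F v : ZMod (2 * k + 1))
      rw [← hz v, ZMod.intCast_eq_intCast_iff_dvd_sub]
      obtain ⟨t, ht⟩ := hFg v
      refine ⟨2 * t + (z v - (C v : ℕ)), ?_⟩
      push_cast at ht ⊢
      linear_combination ht
    rw [hfF]
    refine heightHom_reachable hH _ hc01 hc F (fun v => ?_) hF
    obtain ⟨t, ht⟩ := hFg v
    refine ⟨(2 * k + 1) * t + (k + 1) * (z v - (C v : ℕ)), ?_⟩
    push_cast at ht ⊢
    linear_combination ht
  have : Nonempty (G →g H) := ⟨heightHom hH _ hc⟩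
  exact ⟨fun f g => (hreach f).trans (hreach g).symm⟩

theorem isMixing_cycleGraph [Finite V] (hG : G.IsBipartite) {k : ℕ} (hk : 1 ≤ k)
    (hcyc : ∀ (v : V) (c : G.Walk v v), c.IsCycle → c.length < 4 * k + 2) :
    IsMixing G (SimpleGraph.cycleGraph (2 * k + 1)) := by
  obtain ⟨j, rfl⟩ := Nat.exists_eq_add_of_le' hk
  exact isMixing_of_cycle_length_lt hG (j + 1)
    (H := (SimpleGraph.cycleGraph (2 * (j + 1) + 1) : SimpleGraph (Fin (2 * (j + 1) + 1))))
    (fun x y => Iff.rfl) hcyc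

theorem cycle_length_le_card [Finite V] {v : V} {c : G.Walk v v} (hc : c.IsCycle) :
    c.length ≤ Nat.card V := by
  have := Fintype.ofFinite V
  have h := hc.support_nodup.length_le_card
  rw [List.length_tail, SimpleGraph.Walk.length_support, Nat.card_eq_fintype_card.symm] at h
  exact h

end Heights

/-! ### Odd cycles as circular cliques. -/

/-- Doubling modulo `2 * k + 1` identifies `G_{2k+1,k}` with the odd cycle. -/
theorem circularClique_iso_cycleGraph {k : ℕ} (hk : 1 ≤ k) :
    Nonempty (circularClique (2 * k + 1) k ≃g SimpleGraph.cycleGraph (2 * k + 1)) := by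
  obtain ⟨j, rfl⟩ := Nat.exists_eq_add_of_le' hk
  set k := j + 1 with hkj
  have hunit : (2 : ZMod (2 * k + 1)) * (-(k : ZMod (2 * k + 1))) = 1 := by
    have : ((2 * k + 1 : ℕ) : ZMod (2 * k + 1)) = 0 := ZMod.natCast_self _
    push_cast at this
    linear_combination -this
  let u : (ZMod (2 * k + 1))ˣ := ⟨2, -(k : ZMod (2 * k + 1)), hunit, (mul_comm _ _).trans hunit⟩
  refine ⟨⟨(u.mulLeft : ZMod (2 * k + 1) ≃ ZMod (2 * k + 1)), ?_⟩⟩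
  -- Adjacency in G_{2k+1,k} means a difference ±k or ±(k+1); doubling sends k+1 and -k to 1, and
  -- their negatives to -1.
  have key : ∀ a b : ZMod (2 * k + 1), 2 * a - 2 * b = 1 ↔
      ((a.val : ℤ) - b.val = k + 1 ∨ (a.val : ℤ) - b.val = -k) := by
    intro a b
    have ha := a.val_lt
    have hb := b.val_lt
    have : 2 * a - 2 * b - 1 =
        ((2 * (a.val : ℤ) - 2 * (b.val : ℤ) - 1 : ℤ) : ZMod (2 * k + 1)) := by
      push_cast
      rw [ZMod.natCast_zmod_val, ZMod.natCast_zmod_val]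
    rw [← sub_eq_zero, this, ZMod.intCast_zmod_eq_zero_iff_dvd]
    constructor
    · rintro ⟨t, ht⟩
      push_cast at ht
      have h1 : t < 2 := by
        by_contra hcon
        nlinarith
      have h2 : -2 < t := by
        by_contra hcon
        nlinarith
      interval_cases t <;> omega
    · rintro (h | h)
      · exact ⟨1, by push_cast; omega⟩
      · exact ⟨-1, by push_cast; omega⟩
  intro x y
  have hval : ∀ a : Fin (2 * k + 1), ZMod.val (n := 2 * k + 1) a = a.val := fun _ => rfl
  refine (or_congr (key x y) (key y x)).trans ?_
  rw [hval, hval]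
  change _ ↔ (x ≠ y ∧ _ ∧ _)
  have hx := x.isLt
  have hy := y.isLt
  constructor
  · intro h
    refine ⟨?_, ?_, ?_⟩
    · rintro rfl
      omega
    · rw [le_abs]
      omega
    · rw [abs_le]
      push_cast
      omega
  · rintro ⟨-, h1, h2⟩
    rw [le_abs] at h1
    rw [abs_le] at h2
    push_cast at h1 h2
    omega


/-! ### Clique sizes in circular cliques. -/

section CliqueBound

theorem card_mul_add_le_of_separated {q : ℕ} (T : Finset ℕ) (hT : T.Nonempty)
    (hsep : ∀ x ∈ T, ∀ y ∈ T, x < y → x + q ≤ y) {a b : ℕ} (hab : ∀ x ∈ T, a ≤ x ∧ x ≤ b) :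
    T.card * q + a ≤ b + q := by
  induction T using Finset.induction_on_max generalizing b with
  | empty => exact absurd hT Finset.not_nonempty_empty
  | insert m s hm ih =>
    have hmb := hab m (Finset.mem_insert_self m s)
    rw [Finset.card_insert_of_notMem fun h => lt_irrefl _ (hm m h), add_mul, one_mul]
    rcases s.eq_empty_or_nonempty with rfl | hs
    · simp
      omega
    · have hle : ∀ x ∈ s, x + q ≤ m := fun x hx =>
        hsep x (Finset.mem_insert_of_mem hx) m (Finset.mem_insert_self m s) (hm x hx)
      obtain ⟨x₀, hx₀⟩ := hs
      have := hle x₀ hx₀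
      have := ih ⟨x₀, hx₀⟩ (fun x hx y hy => hsep x (Finset.mem_insert_of_mem hx) y
        (Finset.mem_insert_of_mem hy)) (b := m - q) fun x hx =>
          ⟨(hab x (Finset.mem_insert_of_mem hx)).1, by have := hle x hx; omega⟩
      omega

theorem circularClique_adj_iff {p q : ℕ} {u v : Fin p} : (circularClique p q).Adj u v ↔
    u ≠ v ∧ (q : ℤ) ≤ |(u : ℤ) - (v : ℤ)| ∧ |(u : ℤ) - (v : ℤ)| ≤ (p : ℤ) - (q : ℤ) := Iff.rfl

theorem circularClique_adj_cases {p q : ℕ} {u v : Fin p} (h : (circularClique p q).Adj u v) :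
    u ≠ v ∧ ((u : ℕ) + q ≤ v ∧ (v : ℕ) + q ≤ u + p ∨ (v : ℕ) + q ≤ u ∧ (u : ℕ) + q ≤ v + p) := by
  obtain ⟨h0, h1, h2⟩ := circularClique_adj_iff.1 h
  rw [le_abs] at h1
  rw [abs_le] at h2
  exact ⟨h0, by omega⟩

/-- Cut the circle at the smallest colour a. Adjacency to a confines the clique to [a, a + p - q],
and m points with gaps at least q span at least (m - 1)q. -/
theorem circularClique_clique_card_mul_le {p q m : ℕ} (hqp : q ≤ p) {T : Finset (Fin p)}
    (hT : (circularClique p q).IsNClique m T) : m * q ≤ p := by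
  rcases T.eq_empty_or_nonempty with rfl | hne
  · have := hT.card_eq
    simp only [Finset.card_empty] at this
    simp [← this]
  have hpair : ∀ x ∈ T, ∀ y ∈ T, x ≠ y → (circularClique p q).Adj x y :=
    fun x hx y hy hxy => hT.isClique hx hy hxy
  set a := T.min' hne
  have hcard : (T.map Fin.valEmbedding).card = m := by rw [Finset.card_map, hT.card_eq]
  have := card_mul_add_le_of_separated (q := q) (T.map Fin.valEmbedding) (by simpa using hne)
    (a := a) (b := a + (p - q)) ?_ ?_
  · rw [hcard] at this
    omega
  · simp only [Finset.mem_map, forall_exists_index, and_imp, Fin.valEmbedding_apply]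
    rintro _ x hx rfl _ y hy rfl hxy
    have := circularClique_adj_cases (hpair x hx y hy (Fin.ne_of_lt hxy))
    omega
  · simp only [Finset.mem_map, forall_exists_index, and_imp, Fin.valEmbedding_apply]
    rintro _ x hx rfl
    have hle : a ≤ x := T.min'_le x hx
    have hle' : (a : ℕ) ≤ x := hle
    refine ⟨hle', ?_⟩
    by_cases hax : a = x
    · rw [hax]
      omega
    · have := circularClique_adj_cases (hpair a (T.min'_mem hne) x hx hax)
      omega

end CliqueBound

/-! ### The cyclic order on a clique as an invariant. -/

section Orientation

variable {V : Type*} {G : SimpleGraph V} {p q : ℕ}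

/-- Three numbers are in cyclic order. -/
def CyclicOrder (x y z : ℕ) : Prop := (x < y ∧ y < z) ∨ (y < z ∧ z < x) ∨ (z < x ∧ x < y)

theorem cyclicOrder_rotate {x y z : ℕ} : CyclicOrder x y z ↔ CyclicOrder y z x := by
  unfold CyclicOrder
  omega

/-- Reflection of the circular clique. -/
def circularCliqueRev (p q : ℕ) : circularClique p q →g circularClique p q where
  toFun := Fin.rev
  map_rel' {u v} h := by
    obtain ⟨h0, h1, h2⟩ := circularClique_adj_iff.1 h
    refine circularClique_adj_iff.2 ⟨fun h => h0 (Fin.rev_injective h), ?_⟩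
    have hu := u.isLt
    have hv := v.isLt
    have : ((Fin.rev u : Fin p) : ℤ) - ((Fin.rev v : Fin p) : ℤ) = -((u : ℤ) - (v : ℤ)) := by
      rw [Fin.val_rev, Fin.val_rev]
      omega
    rw [this, abs_neg]
    exact ⟨h1, h2⟩

/-- To reverse the order, the colour of `c` must jump across the colours of `a` and `b`. The old and
new colours of `c` are then far enough apart to coexist in a clique of size m + 1, for which p < (m
+ 1)q leaves no room. -/
theorem cyclicOrder_of_recolour_third {m : ℕ} (hqp : q ≤ p) (hpm : p < (m + 1) * q)
    {S : Finset V} (hS : G.IsNClique m S) {a b c : V} (ha : a ∈ S) (hb : b ∈ S) (hc : c ∈ S)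
    (hab : a ≠ b) (hbc : b ≠ c) (hca : c ≠ a) {f g : G →g circularClique p q}
    (hfg : ∀ w, w ≠ c → f w = g w) (h : CyclicOrder (f a) (f b) (f c)) :
    CyclicOrder (g a) (g b) (g c) := by
  classical
  by_contra hcon
  have adj : ∀ x ∈ S, ∀ y ∈ S, x ≠ y → G.Adj x y := fun x hx y hy hxy => hS.isClique hx hy hxy
  rw [← hfg a hca.symm, ← hfg b hbc] at hcon
  have e1 := circularClique_adj_cases (f.map_adj (adj a ha b hb hab))
  have e2 := circularClique_adj_cases (f.map_adj (adj b hb c hc hbc))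
  have e3 := circularClique_adj_cases (f.map_adj (adj c hc a ha hca))
  have e4 := circularClique_adj_cases (g.map_adj (adj b hb c hc hbc))
  have e5 := circularClique_adj_cases (g.map_adj (adj c hc a ha hca))
  rw [← hfg a hca.symm] at e5
  rw [← hfg b hbc] at e4
  have hq : 0 < q := Nat.pos_of_ne_zero fun h0 => by simp [h0] at hpm
  have hadj : ∀ s ∈ S, (circularClique p q).Adj (g c) (f s) := by
    intro s hs
    by_cases hsc : s = c
    -- The colours of `a` and `b` separate `f c` from `g c` on both arcs, and each is at distance at
    -- least q from both.
    · subst hsc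
      unfold CyclicOrder at h hcon
      refine circularClique_adj_iff.2 ⟨?_, ?_, ?_⟩
      · intro h'
        rw [h'] at hcon
        exact hcon h
      · rw [le_abs]
        omega
      · rw [abs_le]
        omega
    · rw [hfg s hsc]
      exact g.map_adj (adj c hc s hs (Ne.symm hsc))
  have hT : (circularClique p q).IsNClique (m + 1) (insert (g c) (S.image f)) := by
    refine SimpleGraph.IsNClique.insert ⟨?_, ?_⟩ ?_
    · intro x' hx' y' hy' hxy
      obtain ⟨x, hx, rfl⟩ := Finset.mem_image.1 (Finset.mem_coe.1 hx')
      obtain ⟨y, hy, rfl⟩ := Finset.mem_image.1 (Finset.mem_coe.1 hy')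
      exact f.map_adj (adj x hx y hy fun h => hxy (by rw [h]))
    · rw [Finset.card_image_of_injOn, hS.card_eq]
      intro x hx y hy hxy
      by_contra hne
      exact (f.map_adj (adj x hx y hy hne)).ne hxy
    · intro y hy
      obtain ⟨s, hs, rfl⟩ := Finset.mem_image.1 hy
      exact hadj s hs
  exact absurd (circularClique_clique_card_mul_le hqp hT) (not_le.2 hpm)

theorem cyclicOrder_of_recolour {m : ℕ} (hqp : q ≤ p) (hpm : p < (m + 1) * q)
    {S : Finset V} (hS : G.IsNClique m S) {a b c : V} (ha : a ∈ S) (hb : b ∈ S) (hc : c ∈ S)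
    (hab : a ≠ b) (hbc : b ≠ c) (hca : c ≠ a) {f g : G →g circularClique p q} {v : V}
    (hfg : ∀ w, w ≠ v → f w = g w) (h : CyclicOrder (f a) (f b) (f c)) :
    CyclicOrder (g a) (g b) (g c) := by
  by_cases hvc : v = c
  · subst hvc
    exact cyclicOrder_of_recolour_third hqp hpm hS ha hb hc hab hbc hca hfg h
  by_cases hva : v = a
  · subst hva
    rw [cyclicOrder_rotate] at h ⊢
    exact cyclicOrder_of_recolour_third hqp hpm hS hb hc ha hbc hca hab hfg h
  by_cases hvb : v = b
  · subst hvb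
    rw [← cyclicOrder_rotate] at h ⊢
    exact cyclicOrder_of_recolour_third hqp hpm hS hc ha hb hca hab hbc hfg h
  rwa [← hfg a (Ne.symm hva), ← hfg b (Ne.symm hvb), ← hfg c (Ne.symm hvc)]

/-- A graph with a clique of size `m ≥ 3` is not `G_{p,q}`-mixing when `p / q < m + 1`. -/
theorem succ_mul_le_of_isMixing {m : ℕ} (hm : 3 ≤ m) (hqp : q ≤ p) {S : Finset V}
    (hS : G.IsNClique m S) (hmix : IsMixing G (circularClique p q)) : (m + 1) * q ≤ p := by
  by_contra! hpm
  obtain ⟨f⟩ := hmix.nonempty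
  obtain ⟨a, b, c, ha, hb, hc, hab, hac, hbc⟩ :=
    Finset.two_lt_card_iff.1 (show 2 < S.card by rw [hS.card_eq]; omega)
  have hreach := hmix.preconnected f ((circularCliqueRev p q).comp f)
  have hpres : ∀ x ∈ S, ∀ y ∈ S, ∀ z ∈ S, x ≠ y → y ≠ z → z ≠ x →
      CyclicOrder (f x) (f y) (f z) →
        CyclicOrder (Fin.rev (f x)) (Fin.rev (f y)) (Fin.rev (f z)) := by
    intro x hx y hy z hz hxy hyz hzx
    exact rel_of_colGraph_reachable (G := G) (H := circularClique p q)
      (R := fun f g => CyclicOrder (f x) (f y) (f z) → CyclicOrder (g x) (g y) (g z))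
      (fun _ => id) (fun _ _ _ h1 h2 h => h2 (h1 h))
      (fun _ _ v hv => cyclicOrder_of_recolour hqp hpm hS hx hy hz hxy hyz hzx hv) hreach
  -- Three distinct colours are in cyclic order as abc or as acb; whichever holds, reflection
  -- reverses it.
  have h1 := hpres a ha b hb c hc hab hbc hac.symm
  have h2 := hpres a ha c hc b hb hac hbc.symm hab.symm
  have adj : ∀ x ∈ S, ∀ y ∈ S, x ≠ y → (f x : ℕ) ≠ f y := fun x hx y hy hxy h =>
    (f.map_adj (hS.isClique hx hy hxy)).ne (Fin.ext h)
  have e1 := adj a ha b hb hab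
  have e2 := adj b hb c hc hbc
  have e3 := adj a ha c hc hac
  have := (f a).isLt
  have := (f b).isLt
  have := (f c).isLt
  simp only [CyclicOrder, Fin.val_rev] at h1 h2
  omega

end Orientation

/-! ### Clockwise distances and winding for p/q < 4. -/

section Winding

variable {V : Type*} {G : SimpleGraph V} {p q : ℕ}

/-- The clockwise distance between the colours of two vertices. -/
def circDist (f : V → Fin p) (x y : V) : ℤ := (((f y : ℕ) : ℤ) - ((f x : ℕ) : ℤ)) % (p : ℤ)

theorem circDist_cases (f : V → Fin p) (x y : V) :
    (f x : ℕ) ≤ f y ∧ circDist f x y = ((f y : ℕ) : ℤ) - ((f x : ℕ) : ℤ) ∨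
    (f y : ℕ) < f x ∧ circDist f x y = ((f y : ℕ) : ℤ) - ((f x : ℕ) : ℤ) + p := by
  have hx := (f x).isLt
  have hy := (f y).isLt
  unfold circDist
  rcases le_or_gt (f x : ℕ) (f y) with h | h
  · exact Or.inl ⟨h, Int.emod_eq_of_lt (by omega) (by omega)⟩
  · refine Or.inr ⟨h, ?_⟩
    rw [← Int.add_emod_right]
    exact Int.emod_eq_of_lt (by omega) (by omega)

theorem circDist_bounds (f : G →g circularClique p q) {x y : V} (h : G.Adj x y) :
    (q : ℤ) ≤ circDist f x y ∧ circDist f x y ≤ p - q := by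
  have h1 := circularClique_adj_cases (f.map_adj h)
  have h2 := circDist_cases f x y
  omega

theorem circDist_swap (f : G →g circularClique p q) {x y : V} (h : G.Adj x y) :
    circDist f y x = p - circDist f x y := by
  have h1 := circularClique_adj_cases (f.map_adj h)
  have h2 := circDist_cases f x y
  have h3 := circDist_cases f y x
  omega

/-- The colouring `g` arises from `f` by an integral displacement that accounts for the change of
all clockwise distances along edges. -/
def IsDisplaced (f g : G →g circularClique p q) : Prop :=
  ∃ h : V → ℤ, (∀ v, (p : ℤ) ∣ ((g v : ℕ) : ℤ) - ((f v : ℕ) : ℤ) - h v) ∧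
    ∀ x y, G.Adj x y → circDist g x y = circDist f x y + h y - h x

theorem isDisplaced_refl (f : G →g circularClique p q) : IsDisplaced f f :=
  ⟨fun _ => 0, by simp, by simp⟩

theorem isDisplaced_trans {f g k : G →g circularClique p q} (h₁ : IsDisplaced f g)
    (h₂ : IsDisplaced g k) : IsDisplaced f k := by
  obtain ⟨a, ha, ha'⟩ := h₁
  obtain ⟨b, hb, hb'⟩ := h₂
  refine ⟨fun v => a v + b v, fun v => ?_, fun x y hxy => ?_⟩
  · have := (ha v).add (hb v)
    ring_nf at this ⊢
    exact this
  · have := ha' x y hxy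
    have := hb' x y hxy
    linarith

/-- Recolouring `v` changes the distances from all its neighbours by the same amount mod p. Each
change is at most p - 2q in absolute value, so two of them differ by at most 2(p - 2q), which is
less than p exactly when p < 4q. Hence the changes agree as integers. -/
theorem isDisplaced_of_recolour (hpq : p < 4 * q) {f g : G →g circularClique p q} {v : V}
    (hfg : ∀ w, w ≠ v → f w = g w) : IsDisplaced f g := by
  classical
  have hdvd : ∀ x, x ≠ v →
      (p : ℤ) ∣ ((g v : ℕ) : ℤ) - ((f v : ℕ) : ℤ) - (circDist g x v - circDist f x v) := by
    intro x hx
    have h1 := circDist_cases f x v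
    have h2 := circDist_cases g x v
    rw [← hfg x hx] at h2
    rcases h1 with ⟨_, h1⟩ | ⟨_, h1⟩ <;> rcases h2 with ⟨_, h2⟩ | ⟨_, h2⟩
    exacts [⟨0, by rw [h1, h2]; ring⟩, ⟨-1, by rw [h1, h2]; ring⟩, ⟨1, by rw [h1, h2]; ring⟩,
      ⟨0, by rw [h1, h2]; ring⟩]
  obtain ⟨e, he, he'⟩ : ∃ e : ℤ, (p : ℤ) ∣ ((g v : ℕ) : ℤ) - ((f v : ℕ) : ℤ) - e ∧
      ∀ x, G.Adj x v → circDist g x v = circDist f x v + e := by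
    by_cases hv : ∃ x, G.Adj x v
    · obtain ⟨x₀, hx₀⟩ := hv
      refine ⟨_, hdvd x₀ hx₀.ne, fun x hx => ?_⟩
      have h1 := circDist_bounds f hx
      have h2 := circDist_bounds g hx
      have h3 := circDist_bounds f hx₀
      have h4 := circDist_bounds g hx₀
      have h5 := (hdvd x₀ hx₀.ne).sub (hdvd x hx.ne)
      have h6 := Int.eq_zero_of_abs_lt_dvd h5 (by rw [abs_lt]; omega)
      omega
    · exact ⟨((g v : ℕ) : ℤ) - ((f v : ℕ) : ℤ), by simp, fun x hx => absurd ⟨x, hx⟩ hv⟩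
  refine ⟨fun w => if w = v then e else 0, fun w => ?_, fun x y hxy => ?_⟩
  · by_cases hw : w = v
    · subst hw
      simpa using he
    · simp [hw, hfg w hw]
  · by_cases hx : x = v
    · subst hx
      have h1 := he' y hxy.symm
      have h2 := circDist_swap f hxy
      have h3 := circDist_swap g hxy
      simp only [if_true, if_neg hxy.ne']
      omega
    · by_cases hy : y = v
      · subst hy
        have h1 := he' x hxy
        simp only [if_true, if_neg hx]
        omega
      · simp [hx, hy, circDist, hfg x hx, hfg y hy]

/-- A graph which is `G_{p,q}`-mixing for some `p / q < 4` is bipartite. -/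
theorem isBipartite_of_isMixing (hpq : p < 4 * q) (hmix : IsMixing G (circularClique p q)) :
    G.IsBipartite := by
  obtain ⟨f⟩ := hmix.nonempty
  obtain ⟨h, hdvd, hdist⟩ : IsDisplaced f ((circularCliqueRev p q).comp f) :=
    rel_of_colGraph_reachable isDisplaced_refl (fun _ _ _ => isDisplaced_trans)
      (fun _ _ _ => isDisplaced_of_recolour hpq) (hmix.preconnected _ _)
  choose t ht using hdvd
  have hodd : ∀ x y, G.Adj x y → ¬ (Even (t x) ↔ Even (t y)) := by
    intro x y hxy
    have h1 := hdist x y hxy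
    have hx := ht x
    have hy := ht y
    have bx := (f x).isLt
    have by' := (f y).isLt
    have ex : (((circularCliqueRev p q).comp f x : ℕ) : ℤ) = p - 1 - (f x : ℕ) := by
      change ((Fin.rev (f x) : ℕ) : ℤ) = _
      rw [Fin.val_rev]
      omega
    have ey : (((circularCliqueRev p q).comp f y : ℕ) : ℤ) = p - 1 - (f y : ℕ) := by
      change ((Fin.rev (f y) : ℕ) : ℤ) = _
      rw [Fin.val_rev]
      omega
    have h2 := circDist_cases f x y
    have h3 := circDist_cases ((circularCliqueRev p q).comp f) x y
    have hne := (circularClique_adj_cases (f.map_adj hxy)).1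
    have hne' : (f x : ℕ) ≠ f y := fun h => hne (Fin.ext h)
    rw [ex] at hx
    rw [ey] at hy
    have hp : (p : ℤ) ≠ 0 := by omega
    -- Reflection turns d = `circDist f x y` into p - d, so p(t x - t y) = 2(f y - f x) + p - 2d.
    -- This is p or -p according to whether d wraps around; the parity of `t` is thus a 2-colouring.
    have hcase : t x - t y = 1 ∨ t x - t y = -1 := by
      rcases h2 with ⟨_, h2⟩ | ⟨_, h2⟩
      · left
        refine mul_left_cancel₀ hp ?_
        rw [mul_sub, ← hx, ← hy]
        omega
      · right
        refine mul_left_cancel₀ hp ?_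
        rw [mul_sub, ← hx, ← hy]
        omega
    rw [Int.even_iff, Int.even_iff]
    omega
  have hcol := (SimpleGraph.Coloring.mk (fun v => decide (Even (t v)))
    fun {x y} hxy heq => hodd x y hxy (by simpa using heq) : G.Coloring Bool).colorable
  simpa using hcol

end Winding

/-! ### Mixing for complete graphs with many colours. -/

section CompleteGraph

variable {V W : Type*} {G : SimpleGraph V}

theorem circularClique_one (p : ℕ) : circularClique p 1 = ⊤ := by
  ext u v
  rw [circularClique_adj_iff, SimpleGraph.top_adj]
  refine ⟨fun h => h.1, fun h => ⟨h, ?_⟩⟩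
  have := u.isLt
  have := v.isLt
  have : (u : ℕ) ≠ v := fun h' => h (Fin.ext h')
  rw [le_abs, abs_le]
  omega

/-- Colourings can be changed vertex by vertex to an injective one with fresh colours. -/
theorem colGraph_top_reachable_of_injective [Finite V] (f : G →g (⊤ : SimpleGraph W)) (h : V → W)
    (hinj : Function.Injective h) (hdisj : ∀ u v, h u ≠ f v) :
    (colGraph G ⊤).Reachable f ⟨h, fun {_ _} huv => hinj.ne huv.ne⟩ := by
  classical
  have := Fintype.ofFinite V
  let k : Finset V → (G →g (⊤ : SimpleGraph W)) := fun A =>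
    ⟨fun v => if v ∈ A then h v else f v, fun {u v} huv => by
      rw [SimpleGraph.top_adj]
      split_ifs
      · exact hinj.ne huv.ne
      · exact hdisj u v
      · exact (hdisj v u).symm
      · exact (f.map_adj huv).ne⟩
  have hk : ∀ A, (colGraph G ⊤).Reachable f (k A) := by
    intro A
    induction A using Finset.induction_on with
    | empty =>
      have : k ∅ = f := RelHom.ext fun v => by simp [k]
      rw [this]
    | insert a A ha ih =>
      refine ih.trans (colGraph_reachable_of_subsingleton ?_)
      have hsub : ∀ x, k A x ≠ k (insert a A) x → x = a := by
        intro x hx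
        by_contra hxa
        exact hx (by simp [k, hxa])
      exact fun x hx y hy => (hsub x hx).trans (hsub y hy).symm
  have : k Finset.univ = ⟨h, fun {_ _} huv => hinj.ne huv.ne⟩ :=
    RelHom.ext fun v => by simp [k]
  rw [← this]
  exact hk _

/-- Two colourings use at most 2|V| colours, leaving |V| fresh ones for an injective colouring
reachable from both. This keeps the set defining the circular mixing number nonempty. -/
theorem isMixing_top_of_card_le [Finite V] [Finite W] (hW : 3 * Nat.card V ≤ Nat.card W) :
    IsMixing G (⊤ : SimpleGraph W) := by
  classical
  have := Fintype.ofFinite V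
  have := Fintype.ofFinite W
  rw [Nat.card_eq_fintype_card, Nat.card_eq_fintype_card] at hW
  obtain ⟨j⟩ : Nonempty (V ↪ W) := Function.Embedding.nonempty_of_card_le (by omega)
  have : Nonempty (G →g (⊤ : SimpleGraph W)) := ⟨⟨j, fun {_ _} huv => j.injective.ne huv.ne⟩⟩
  refine ⟨fun f g => ?_⟩
  let T : Finset W := (Finset.univ.image f ∪ Finset.univ.image g)ᶜ
  have hT : Fintype.card V ≤ Fintype.card T := by
    rw [Fintype.card_coe, Finset.card_compl]
    have h1 := Finset.card_union_le (Finset.univ.image f) (Finset.univ.image g)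
    have h2 : (Finset.univ.image f).card ≤ Fintype.card V := Finset.card_image_le
    have h3 : (Finset.univ.image g).card ≤ Fintype.card V := Finset.card_image_le
    omega
  obtain ⟨h⟩ := Function.Embedding.nonempty_of_card_le hT
  have hh : ∀ u v, (h u : W) ≠ f v ∧ (h u : W) ≠ g v := by
    intro u v
    have := (h u).2
    simp only [T, Finset.mem_compl, Finset.mem_union, Finset.mem_image, Finset.mem_univ, true_and,
      not_or, not_exists] at this
    exact ⟨fun h' => this.1 v h'.symm, fun h' => this.2 v h'.symm⟩
  have hinj : Function.Injective fun v => (h v : W) := Subtype.val_injective.comp h.injective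
  exact (colGraph_top_reachable_of_injective f _ hinj fun u v => (hh u v).1).trans
    (colGraph_top_reachable_of_injective g _ hinj fun u v => (hh u v).2).symm

end CompleteGraph

/-! ### The circular mixing number and the final assembly. -/

theorem circularMixingNumber_eq_two {V : Type*} [Finite V] {G : SimpleGraph V}
    (hG : G.IsBipartite) : circularMixingNumber G = 2 := by
  have hmem : ∀ k : ℕ, Nat.card V + 1 ≤ k → ((2 * k + 1 : ℕ) : ℝ) / k ∈
      {r : ℝ | ∃ p q : ℕ, 0 < q ∧ 2 * q ≤ p ∧ IsMixing G (circularClique p q) ∧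
        r = (p : ℝ) / (q : ℝ)} := by
    intro k hk
    refine ⟨2 * k + 1, k, by omega, by omega, ?_, rfl⟩
    obtain ⟨e⟩ := circularClique_iso_cycleGraph (show 1 ≤ k by omega)
    rw [isMixing_congr e]
    refine isMixing_cycleGraph hG (by omega) fun v c hc => ?_
    have := cycle_length_le_card hc
    omega
  have hbdd : ∀ r ∈ {r : ℝ | ∃ p q : ℕ, 0 < q ∧ 2 * q ≤ p ∧
      IsMixing G (circularClique p q) ∧ r = (p : ℝ) / (q : ℝ)}, (2 : ℝ) ≤ r := by
    rintro _ ⟨p, q, hq, hpq, -, rfl⟩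
    rw [le_div_iff₀ (by exact_mod_cast hq)]
    exact_mod_cast hpq
  refine le_antisymm (le_of_forall_pos_lt_add fun ε hε => ?_)
    (le_csInf ⟨_, hmem _ le_rfl⟩ hbdd)
  -- The index k = n + |V| + 1 exceeds 1/ε, so 2 + 1/k < 2 + ε, and is large enough for the cycle
  -- condition.
  obtain ⟨n, hn⟩ := exists_nat_gt (1 / ε)
  have hk := hmem (n + Nat.card V + 1) (by omega)
  refine lt_of_le_of_lt (csInf_le ⟨2, hbdd⟩ hk) ?_
  have hnε : 1 < n * ε := (div_lt_iff₀ hε).1 hn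
  have hV : (0 : ℝ) ≤ Nat.card V := Nat.cast_nonneg _
  have hn0 : (0 : ℝ) ≤ n := Nat.cast_nonneg _
  push_cast
  rw [div_lt_iff₀ (by positivity)]
  nlinarith [mul_nonneg hV hε.le]

theorem max_le_circularMixingNumber {V : Type*} [Finite V] {G : SimpleGraph V}
    (hG : ¬ G.IsBipartite) : max 4 ((G.cliqueNum : ℝ) + 1) ≤ circularMixingNumber G := by
  -- Nonemptiness matters, since the real infimum of the empty set is 0. The summand 2 secures p ≥
  -- 2q when `V` is empty.
  refine le_csInf ⟨_, 3 * Nat.card V + 2, 1, one_pos, by omega, ?_, rfl⟩ ?_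
  · rw [circularClique_one]
    exact isMixing_top_of_card_le (by rw [Nat.card_fin]; omega)
  · rintro _ ⟨p, q, hq, hpq, hmix, rfl⟩
    have hq' : (0 : ℝ) < q := by exact_mod_cast hq
    have h4 : 4 * q ≤ p := by
      by_contra! hlt
      exact hG (isBipartite_of_isMixing hlt hmix)
    rw [le_div_iff₀ hq']
    have h : max 4 (G.cliqueNum + 1) * q ≤ p := by
      -- The bound 4 dominates unless the clique number is at least 3, the range where a cyclic
      -- order on the clique makes sense.
      rcases le_total (G.cliqueNum + 1) 4 with hle | hle
      · rwa [max_eq_left hle]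
      · rw [max_eq_right hle]
        obtain ⟨S, hS⟩ := G.exists_isNClique_cliqueNum
        exact succ_mul_le_of_isMixing (by omega) (by omega) hS hmix
    exact_mod_cast h

theorem theorem2p5 {V : Type*} [Finite V] (G : SimpleGraph V) :
    (G.IsBipartite →
      (∃ k : ℕ, 1 ≤ k ∧ IsMixing G (SimpleGraph.cycleGraph (2 * k + 1))) ∧
      (∃ k₀ : ℕ, ∀ k : ℕ, k₀ ≤ k → IsMixing G (SimpleGraph.cycleGraph (2 * k + 1))) ∧
      (∀ k : ℕ, 1 ≤ k →
        (∀ (v : V) (c : G.Walk v v), c.IsCycle → c.length < 4 * k + 2) →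
        IsMixing G (SimpleGraph.cycleGraph (2 * k + 1))) ∧
      circularMixingNumber G = 2) ∧
    (¬ G.IsBipartite →
      max 4 ((G.cliqueNum : ℝ) + 1) ≤ circularMixingNumber G) := by
  refine ⟨fun hG => ?_, max_le_circularMixingNumber⟩
  have hlarge : ∀ k, Nat.card V + 1 ≤ k →
      IsMixing G (SimpleGraph.cycleGraph (2 * k + 1)) := fun k hk =>
    isMixing_cycleGraph hG (by omega) fun v c hc => by
      have := cycle_length_le_card hc
      omega
  exact ⟨⟨Nat.card V + 1, by omega, hlarge _ le_rfl⟩, ⟨_, hlarge⟩,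
    fun _ hk hcyc => isMixing_cycleGraph hG hk hcyc, circularMixingNumber_eq_two hG⟩
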